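/- Let $n\ge 2$ and let $X_1,\dots,X_n$ be mutually independent random variables on a probability space $(\Omega,\mathcal F,\mathbb P)$, each almost surely positive, and not all of them almost surely constant. Put $S_X=X_1+\cdots+X_n$, $R_i=X_i/S_X$, $\boldsymbol R=(R_1,\dots,R_n)$, and, for $q\in[0,1)$, $s_q=\inf\{s\in[0,\infty):\mathbb P(S_X\le s)\ge q\}$. For $k\in\mathbb N$ let $\mathfrak W_k$ be the set of all portfolios $\boldsymbol X=(X_1,\dots,X_n)$ of almost surely positive random variables with $\mathbb E[X_i^k]<\infty$ for all $i$ such that $$\frac{\mathbb E[X_i^k\mid S_X>s_q]}{\mathbb E[S_X^k\mid S_X>s_q]}=\mathbb E[R_i^k\mid S_X>s_q]$$ for all $i\in\{1,\dots,n\}$ and all $q\in[0,1)$ with $\mathbb P(S_X>s_q)>0$. Then $\boldsymbol X\in\mathfrak W_1\cap\mathfrak W_2$ if and only if there are $\theta>0$ and $\gamma_1,\dots,\gamma_n>0$ such that each $X_i$ has the gamma distribution with shape $\gamma_i$ and scale $\theta$, i.e. has density $x^{\gamma_i-1}e^{-x/\theta}/(\Gamma(\gamma_i)\theta^{\gamma_i})$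 on $(0,\infty)$. In this case, $\boldsymbol R$ is independent of $S_X$. -/

import Mathlib

open MeasureTheory ProbabilityTheory

noncomputable section

namespace LossPortfolio

variable {Ω : Type*} [MeasurableSpace Ω] {n : ℕ}

/-- A loss: a random variable that is positive almost surely. -/
def IsLoss (P : Measure Ω) (Y : Ω → ℝ) : Prop :=
  Measurable Y ∧ ∀ᵐ ω ∂P, 0 < Y ω

/-- The aggregate loss `S_X = X_1 + ⋯ + X_n`. -/
def aggregate (X : Fin n → Ω → ℝ) (ω : Ω) : ℝ := ∑ i, X i ω

/-- The ratio `R_i = X_i / S_X`. -/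
def ratio (X : Fin n → Ω → ℝ) (i : Fin n) (ω : Ω) : ℝ := X i ω / aggregate X ω

/-- `VaR_q(Y) = inf {s ∈ [0, ∞) : P(Y ≤ s) ≥ q}`. -/
def valueAtRisk (P : Measure Ω) (Y : Ω → ℝ) (q : ℝ) : ℝ :=
  sInf {s : ℝ | 0 ≤ s ∧ q ≤ P.real {ω | Y ω ≤ s}}

/-- The tail event `{S_X > s_q}` with `s_q = VaR_q(S_X)`. -/
def tailEvent (P : Measure Ω) (X : Fin n → Ω → ℝ) (q : ℝ) : Set Ω :=
  {ω | valueAtRisk P (aggregate X) q < aggregate X ω}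

/-- `E[Y | S_X > s_q]`, meaningful when the tail event has positive probability. -/
def tailExp (P : Measure Ω) (X : Fin n → Ω → ℝ) (q : ℝ) (Y : Ω → ℝ) : ℝ :=
  ∫ ω, Y ω ∂(cond P (tailEvent P X q))

/-- `r^k_{q,i} = E[X_i^k | S_X > s_q] / E[S_X^k | S_X > s_q]`. -/
def propAlloc (P : Measure Ω) (X : Fin n → Ω → ℝ) (k : ℕ) (q : ℝ) (i : Fin n) : ℝ :=
  tailExp P X q (fun ω => X i ω ^ k) / tailExp P X q (fun ω => aggregate X ω ^ k)

/-- The alternative allocation `E[R_i^k | S_X > s_q]`. -/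
def ratioAlloc (P : Measure Ω) (X : Fin n → Ω → ℝ) (k : ℕ) (q : ℝ) (i : Fin n) : ℝ :=
  tailExp P X q (fun ω => ratio X i ω ^ k)

/-- The class `𝔚_k`: portfolios of losses with finite `k`-th moments whose two allocations of
order `k` agree for every business unit `i` and for every level `q ∈ [0, 1)` at which the
conditional expectations given `S_X > s_q` are defined, that is, `P(S_X > s_q) > 0`. -/
def frakW (P : Measure Ω) (n k : ℕ) : Set (Fin n → Ω → ℝ) :=
  {X | (∀ i, IsLoss P (X i) ∧ MemLp (X i) k P) ∧
    ∀ q ∈ Set.Ico (0 : ℝ) 1, 0 < P (tailEvent P X q) →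
      ∀ i, propAlloc P X k q i = ratioAlloc P X k q i}

/-- The gamma distribution with shape `γ` and scale `θ` (so with rate `1 / θ`):
density `x ^ (γ - 1) * exp (-x / θ) / (Γ(γ) * θ ^ γ)` on the positive half-line. -/
def gammaShapeScale (γ θ : ℝ) : Measure ℝ := gammaMeasure γ θ⁻¹

end LossPortfolio

end

namespace LossPortfolio

/-! ### Laplace transforms of measures on the half-line -/

/-! Necessity. Put `R = R_i`, `S = S_X`. Membership in `𝔚_k` says that `R ^ k` and `S ^ k` are
uncorrelated on every tail `{S > s}`. This forces `E[R ^ k | S]` to be constant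
(`ae_eq_integral_of_tail_uncorrelated`, `integral_ratio_pow_mul_of_mem_frakW`). Testing against `S ^
k * exp (t S)` with `t < 0` turns `R ^ k S ^ k` into `X_i ^ k`, and by independence the other
summands cancel (`integral_pow_mul_exp_of_mem_frakW`). Write `K_i`, `K` for the cumulant generating
functions of `X_i`, `S`, and `c_i = E[R_i]`, `d = E[R_i ^ 2]` for one fixed `i`. Then `k = 1` gives
`K_i' = c_i K'` for every index, and `k = 2` at the fixed index gives `K_i'' + K_i' ^ 2 = d (K'' +
K' ^ 2)`. Together they yield the Riccati equation `(c_i - d) K'' = (d - c_i ^ 2) K' ^ 2`, so `K' =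
1 / (b - κ t)`, and each `K_i` is that of a gamma law with shape `c_i / κ` and rate `b / κ`
(`hasLaw_gamma_of_deriv_cgf`).

Sufficiency. For independent gamma variables of common rate, tilting the joint law by `exp (-s S)`
is, up to a constant, the same as rescaling all coordinates (`map_withDensity_exp_sum`). Ratios are
scale invariant, so tilting does not affect their law. Hence the Laplace transform of `S` restricted
to an event of the ratios is proportional to the unrestricted one, which is independence. Both
allocations then equal `E[R_i ^ k]`. -/

theorem integrable_polynomial_eval_of_ae_mem_Icc {μ : Measure ℝ} [IsFiniteMeasure μ]
    (hμ : ∀ᵐ x ∂μ, x ∈ Set.Icc (0 : ℝ) 1) (p : Polynomial ℝ) :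
    Integrable (fun x => p.eval x) μ := by
  obtain ⟨C, hC⟩ := (isCompact_Icc (a := (0 : ℝ)) (b := 1)).exists_bound_of_continuousOn
    p.continuous.continuousOn
  exact Integrable.of_bound p.continuous.aestronglyMeasurable C (hμ.mono fun x hx => hC x hx)

/-- Finite measures on `[0, 1]` are determined by their moments. -/
theorem ext_of_moments_of_ae_mem_Icc {μ ν : Measure ℝ} [IsFiniteMeasure μ] [IsFiniteMeasure ν]
    (hμ : ∀ᵐ x ∂μ, x ∈ Set.Icc (0 : ℝ) 1) (hν : ∀ᵐ x ∂ν, x ∈ Set.Icc (0 : ℝ) 1)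
    (h : ∀ k : ℕ, ∫ x, x ^ k ∂μ = ∫ x, x ^ k ∂ν) : μ = ν := by
  have hmono : ∀ (ρ : Measure ℝ) [IsFiniteMeasure ρ], (∀ᵐ x ∂ρ, x ∈ Set.Icc (0 : ℝ) 1) →
      ∀ p : Polynomial ℝ, ∫ x, p.eval x ∂ρ =
        ∑ k ∈ Finset.range (p.natDegree + 1), p.coeff k * ∫ x, x ^ k ∂ρ := by
    intro ρ _ hρ p
    simp_rw [Polynomial.eval_eq_sum_range]
    rw [integral_finsetSum]
    · simp_rw [integral_const_mul]
    · intro k _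
      simpa using (integrable_polynomial_eval_of_ae_mem_Icc hρ (Polynomial.X ^ k)).const_mul
        (p.coeff k)
  have hclose : ∀ (ρ : Measure ℝ) [IsFiniteMeasure ρ], (∀ᵐ x ∂ρ, x ∈ Set.Icc (0 : ℝ) 1) →
      ∀ (f : BoundedContinuousFunction ℝ ℝ) (p : Polynomial ℝ) (ε : ℝ),
      (∀ x ∈ Set.Icc (0 : ℝ) 1, |p.eval x - f x| < ε) →
      |∫ x, p.eval x ∂ρ - ∫ x, f x ∂ρ| ≤ ε * ρ.real Set.univ := by
    intro ρ _ hρ f p ε hp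
    rw [← integral_sub (integrable_polynomial_eval_of_ae_mem_Icc hρ p) (f.integrable ρ)]
    rw [← Real.norm_eq_abs]
    exact norm_integral_le_of_norm_le_const
      (f := fun x => p.eval x - f x) (hρ.mono fun x hx => (hp x hx).le)
  refine ext_of_forall_integral_eq_of_IsFiniteMeasure fun f => ?_
  set K := μ.real Set.univ + ν.real Set.univ + 1 with hK
  have hKpos : 0 < K := by positivity
  refine eq_of_abs_sub_le_all fun ε hε => ?_
  -- Weierstrass approximation; `K` dominates the two total masses, and its `+ 1` keeps it positive
  -- even for zero measures.
  obtain ⟨p, hp⟩ := exists_polynomial_near_of_continuousOn 0 1 f f.continuous.continuousOn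
    (ε / K) (by positivity)
  have h1 := hclose μ hμ f p _ hp
  have h2 := hclose ν hν f p _ hp
  have h3 : ∫ x, p.eval x ∂μ = ∫ x, p.eval x ∂ν := by
    rw [hmono μ hμ, hmono ν hν]; simp_rw [h]
  rw [h3] at h1
  have h4 : ε / K * μ.real Set.univ + ε / K * ν.real Set.univ ≤ ε := by
    have : ε / K * K = ε := by field_simp
    have : 0 < ε / K := by positivity
    nlinarith
  rw [abs_le] at *
  constructor <;> linarith [h1.1, h1.2, h2.1, h2.2]

/-- A finite measure on `[0, ∞)` is determined by its Laplace transform at the integers. -/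
theorem ext_of_laplace {μ ν : Measure ℝ} [IsFiniteMeasure μ] [IsFiniteMeasure ν]
    (hμ : ∀ᵐ x ∂μ, 0 ≤ x) (hν : ∀ᵐ x ∂ν, 0 ≤ x)
    (h : ∀ k : ℕ, ∫ x, Real.exp (-(k * x)) ∂μ = ∫ x, Real.exp (-(k * x)) ∂ν) : μ = ν := by
  -- Under `y = exp (-x)` the transform at the integer `k` becomes the `k`-th moment of a measure on
  -- `[0, 1]`; `-log` undoes the substitution.
  have hm : Measurable fun x : ℝ => Real.exp (-x) := by fun_prop
  have hmap : μ.map (fun x => Real.exp (-x)) = ν.map (fun x => Real.exp (-x)) := by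
    apply ext_of_moments_of_ae_mem_Icc
    · refine (ae_map_iff hm.aemeasurable (p := fun y => y ∈ Set.Icc (0 : ℝ) 1)
        measurableSet_Icc).mpr ?_
      exact hμ.mono fun x hx => ⟨(Real.exp_pos _).le, by simpa using hx⟩
    · refine (ae_map_iff hm.aemeasurable (p := fun y => y ∈ Set.Icc (0 : ℝ) 1)
        measurableSet_Icc).mpr ?_
      exact hν.mono fun x hx => ⟨(Real.exp_pos _).le, by simpa using hx⟩
    · intro k
      rw [integral_map hm.aemeasurable (by fun_prop), integral_map hm.aemeasurable (by fun_prop)]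
      have h' := h k
      simp_rw [← Real.exp_nat_mul]
      simpa using h'
  have hinv : ∀ ρ : Measure ℝ, (ρ.map (fun x => Real.exp (-x))).map (fun x => -Real.log x) = ρ := by
    intro ρ
    rw [Measure.map_map (by fun_prop) hm]
    have : (fun x => -Real.log x) ∘ (fun x : ℝ => Real.exp (-x)) = id := by
      ext x; simp
    rw [this, Measure.map_id]
  rw [← hinv μ, ← hinv ν, hmap]

/-! ### The gamma distribution -/

theorem ae_pos_gammaMeasure (a r : ℝ) : ∀ᵐ x ∂gammaMeasure a r, 0 < x := by
  have h0 : ∀ᵐ x ∂gammaMeasure a r, x ≠ 0 :=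
    (withDensity_absolutelyContinuous volume (gammaPDF a r)).ae_le (Measure.ae_ne volume 0)
  have h1 : ∀ᵐ x ∂gammaMeasure a r, ¬ x < 0 := by
    rw [ae_iff]
    simp only [not_not]
    change gammaMeasure a r (Set.Iio 0) = 0
    rw [gammaMeasure, withDensity_apply _ measurableSet_Iio]
    exact lintegral_gammaPDF_of_nonpos le_rfl
  filter_upwards [h0, h1] with x hx hx'
  exact lt_of_le_of_ne (not_lt.mp hx') hx.symm

theorem measurable_gammaPDF (a r : ℝ) : Measurable (gammaPDF a r) :=
  (measurable_gammaPDFReal a r).ennreal_ofReal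

/-- Exponential tilting of a gamma distribution changes its rate only. -/
theorem gammaMeasure_withDensity_exp {a r s : ℝ} (ha : 0 < a) (hr : 0 < r) (hs : 0 < r + s) :
    (gammaMeasure a r).withDensity (fun x => ENNReal.ofReal (Real.exp (-(s * x)))) =
      ENNReal.ofReal ((r / (r + s)) ^ a) • gammaMeasure a (r + s) := by
  have hg := measurable_gammaPDF
  rw [gammaMeasure, gammaMeasure, ← withDensity_mul _ (hg a r) (by fun_prop),
    ← withDensity_smul _ (hg a (r + s))]
  congr 1
  ext x
  simp only [Pi.mul_apply, Pi.smul_apply, smul_eq_mul, gammaPDF]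
  rw [← ENNReal.ofReal_mul (gammaPDFReal_nonneg ha hr x), ← ENNReal.ofReal_mul (by positivity)]
  congr 1
  unfold gammaPDFReal
  split_ifs with hx
  · have : Real.exp (-((r + s) * x)) = Real.exp (-(r * x)) * Real.exp (-(s * x)) := by
      rw [← Real.exp_add]; ring_nf
    rw [this, Real.div_rpow hr.le hs.le]
    have : (r + s) ^ a ≠ 0 := (Real.rpow_pos_of_pos hs a).ne'
    field_simp
  · simp

theorem lintegral_exp_gammaMeasure {a r s : ℝ} (ha : 0 < a) (hr : 0 < r) (hs : 0 < r + s) :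
    ∫⁻ x, ENNReal.ofReal (Real.exp (-(s * x))) ∂gammaMeasure a r =
      ENNReal.ofReal ((r / (r + s)) ^ a) := by
  have := isProbabilityMeasure_gammaMeasure ha hs
  have h := congrArg (fun ρ : Measure ℝ => ρ Set.univ) (gammaMeasure_withDensity_exp ha hr hs)
  simpa using h

theorem integrable_exp_gammaMeasure {a r s : ℝ} (ha : 0 < a) (hr : 0 < r) (hs : 0 < r + s) :
    Integrable (fun x => Real.exp (-(s * x))) (gammaMeasure a r) := by
  refine ⟨by fun_prop, ?_⟩
  rw [hasFiniteIntegral_iff_ofReal (ae_of_all _ fun x => (Real.exp_pos _).le),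
    lintegral_exp_gammaMeasure ha hr hs]
  exact ENNReal.ofReal_lt_top

theorem integral_exp_gammaMeasure {a r s : ℝ} (ha : 0 < a) (hr : 0 < r) (hs : 0 < r + s) :
    ∫ x, Real.exp (-(s * x)) ∂gammaMeasure a r = (r / (r + s)) ^ a := by
  rw [integral_eq_lintegral_of_nonneg_ae (ae_of_all _ fun x => (Real.exp_pos _).le) (by fun_prop),
    lintegral_exp_gammaMeasure ha hr hs, ENNReal.toReal_ofReal (by positivity)]

theorem map_mul_gammaMeasure {a r c : ℝ} (ha : 0 < a) (hr : 0 < r) (hc : 0 < c) :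
    (gammaMeasure a r).map (fun x => c * x) = gammaMeasure a (r / c) := by
  have hm : Measurable fun x : ℝ => c * x := by fun_prop
  have h1 := isProbabilityMeasure_gammaMeasure ha hr
  have h2 := isProbabilityMeasure_gammaMeasure ha (div_pos hr hc)
  have h3 := Measure.isProbabilityMeasure_map (μ := gammaMeasure a r) hm.aemeasurable
  apply ext_of_laplace
  · rw [ae_map_iff hm.aemeasurable measurableSet_Ici]
    exact (ae_pos_gammaMeasure a r).mono fun x hx => by positivity
  · exact (ae_pos_gammaMeasure a _).mono fun x hx => hx.le
  · intro k
    rw [integral_map hm.aemeasurable (by fun_prop),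
      integral_exp_gammaMeasure ha (div_pos hr hc) (by positivity)]
    have := integral_exp_gammaMeasure (s := k * c) ha hr (by positivity)
    simp_rw [mul_assoc] at this
    rw [this]
    congr 1
    field_simp

theorem memLp_id_gammaMeasure {a r : ℝ} (ha : 0 < a) (hr : 0 < r) (k : ℕ) :
    MemLp id k (gammaMeasure a r) := by
  have h := memLp_of_mem_interior_integrableExpSet (X := id) (μ := gammaMeasure a r) ?_ k
  · simpa using h
  · refine mem_interior.mpr ⟨Set.Iio r, fun t ht => ?_, isOpen_Iio, hr⟩
    have := integrable_exp_gammaMeasure (s := -t) ha hr (by simpa using ht)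
    simpa [integrableExpSet] using this

/-! ### Functions whose tail averages are uncorrelated with a monotone weight -/

/-- Upper half-lines form a π-system generating the Borel sets. The total integral, needed for
complements, is the limit along `(-k, ∞)`. -/
theorem ae_eq_zero_of_forall_setIntegral_Ioi_eq_zero {μ : Measure ℝ} {f : ℝ → ℝ}
    (hf : Integrable f μ) (h : ∀ s, ∫ x in Set.Ioi s, f x ∂μ = 0) : f =ᵐ[μ] 0 := by
  have huniv : ∫ x, f x ∂μ = 0 := by
    have hU : (⋃ k : ℕ, Set.Ioi (-(k : ℝ))) = Set.univ := by
      refine Set.eq_univ_of_forall fun x => Set.mem_iUnion.mpr ?_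
      obtain ⟨k, hk⟩ := exists_nat_gt (-x)
      exact ⟨k, by simp only [Set.mem_Ioi]; linarith⟩
    have := tendsto_setIntegral_of_monotone (μ := μ) (f := f) (s := fun k : ℕ => Set.Ioi (-(k : ℝ)))
      (fun _ => measurableSet_Ioi)
      (fun i j hij => Set.Ioi_subset_Ioi (by simpa using hij)) hf.integrableOn
    rw [hU, Measure.restrict_univ] at this
    simp_rw [h] at this
    exact tendsto_nhds_unique this tendsto_const_nhds
  have hall : ∀ s, MeasurableSet s → ∫ x in s, f x ∂μ = 0 := by
    intro s hs
    induction s, hs using MeasurableSpace.induction_on_inter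
      (BorelSpace.measurable_eq.trans (borel_eq_generateFrom_Ioi ℝ)) isPiSystem_Ioi with
    | empty => simp
    | basic t ht => obtain ⟨s, rfl⟩ := ht; exact h s
    | compl t ht ih =>
      have h1 := integral_add_compl ht hf
      linarith
    | iUnion f hd hm ih =>
      rw [integral_iUnion hm hd hf.integrableOn]
      simp [ih]
  exact hf.ae_eq_zero_of_forall_setIntegral_eq_zero fun s hs _ => hall s hs

/-- The plane splits into two open triangles exchanged by the swap, and the diagonal, which is
charged only by atoms. -/
theorem integral_prod_eq_of_symm {μ : Measure ℝ} [IsFiniteMeasure μ] {φ : ℝ × ℝ → ℝ}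
    (hφ : Integrable φ (μ.prod μ)) (hsymm : ∀ x y, φ (x, y) = φ (y, x)) :
    Integrable (fun x => ∫ y in Set.Ioi x, φ (x, y) ∂μ) μ ∧
    Integrable (fun x => μ.real {x} * φ (x, x)) μ ∧
    ∫ p, φ p ∂(μ.prod μ) =
      2 * ∫ x, ∫ y in Set.Ioi x, φ (x, y) ∂μ ∂μ + ∫ x, μ.real {x} * φ (x, x) ∂μ := by
  have hlt : MeasurableSet {p : ℝ × ℝ | p.1 < p.2} := measurableSet_lt measurable_fst measurable_snd
  have hgt : MeasurableSet {p : ℝ × ℝ | p.2 < p.1} := measurableSet_lt measurable_snd measurable_fst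
  have heq : MeasurableSet {p : ℝ × ℝ | p.1 = p.2} :=
    measurableSet_eq_fun measurable_fst measurable_snd
  have hi1 := hφ.indicator hlt
  have hi2 := hφ.indicator hgt
  have hi3 := hφ.indicator heq
  have e1 : ∀ x, ∫ y, {p : ℝ × ℝ | p.1 < p.2}.indicator φ (x, y) ∂μ =
      ∫ y in Set.Ioi x, φ (x, y) ∂μ := fun x => by
    rw [← integral_indicator measurableSet_Ioi]; rfl
  have e3 : ∀ x, ∫ y, {p : ℝ × ℝ | p.1 = p.2}.indicator φ (x, y) ∂μ = μ.real {x} * φ (x, x) :=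
      fun x => by
    have : (fun y => {p : ℝ × ℝ | p.1 = p.2}.indicator φ (x, y)) =
        ({x} : Set ℝ).indicator (fun _ => φ (x, x)) := by
      ext y
      by_cases hxy : x = y
      · subst hxy; simp
      · simp [hxy, Ne.symm hxy]
    rw [this, integral_indicator (measurableSet_singleton x), setIntegral_const, smul_eq_mul]
  have h2 : ∫ p, {p : ℝ × ℝ | p.2 < p.1}.indicator φ p ∂(μ.prod μ) =
      ∫ p, {p : ℝ × ℝ | p.1 < p.2}.indicator φ p ∂(μ.prod μ) := by
    rw [← integral_prod_swap]
    refine integral_congr_ae (ae_of_all _ fun p => ?_)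
    obtain ⟨x, y⟩ := p
    simp only [Prod.swap, Set.indicator, Set.mem_ofPred_eq]
    rw [hsymm]
  have hsum : φ = fun p => {p : ℝ × ℝ | p.1 < p.2}.indicator φ p +
      {p : ℝ × ℝ | p.2 < p.1}.indicator φ p + {p : ℝ × ℝ | p.1 = p.2}.indicator φ p := by
    ext ⟨x, y⟩
    rcases lt_trichotomy x y with hxy | hxy | hxy
    · simp [Set.indicator, hxy, hxy.not_gt, hxy.ne]
    · simp [Set.indicator, hxy]
    · simp [Set.indicator, hxy, hxy.not_gt, hxy.ne']
  refine ⟨?_, ?_, ?_⟩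
  · simpa only [e1] using hi1.integral_prod_left
  · simpa only [e3] using hi3.integral_prod_left
  · have hi12 : Integrable (fun p => {p : ℝ × ℝ | p.1 < p.2}.indicator φ p +
        {p : ℝ × ℝ | p.2 < p.1}.indicator φ p) (μ.prod μ) := hi1.add hi2
    rw [integral_congr_ae (ae_of_all _ (congrFun hsum)), integral_add hi12 hi3,
      integral_add hi1 hi2, h2, integral_prod _ hi1,
      integral_prod _ hi3]
    simp_rw [e1, e3]
    ring

theorem integral_sub_mul_sub {ρ : Measure ℝ} [IsFiniteMeasure ρ] {g w : ℝ → ℝ}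
    (hg : Integrable g ρ) (hw : Integrable w ρ) (hgw : Integrable (fun x => g x * w x) ρ)
    (a b : ℝ) :
    ∫ y, (a - g y) * (b - w y) ∂ρ =
      a * b * ρ.real Set.univ - a * ∫ y, w y ∂ρ - b * ∫ y, g y ∂ρ + ∫ y, g y * w y ∂ρ := by
  have : (fun y => (a - g y) * (b - w y)) = fun y => a * b - a * w y - b * g y + g y * w y := by
    ext y; ring
  have i1 : Integrable (fun y => a * w y) ρ := hw.const_mul a
  have i2 : Integrable (fun y => b * g y) ρ := hg.const_mul b
  have i0 : Integrable (fun _ : ℝ => a * b) ρ := integrable_const _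
  have i01 : Integrable (fun y => a * b - a * w y) ρ := i0.sub i1
  have i012 : Integrable (fun y => a * b - a * w y - b * g y) ρ := i01.sub i2
  rw [this, integral_add i012 hgw, integral_sub i01 i2,
    integral_sub i0 i1, integral_const, integral_const_mul, integral_const_mul, smul_eq_mul]
  ring

theorem integrable_sub_mul_sub_prod {ρ : Measure ℝ} [IsFiniteMeasure ρ] {g w : ℝ → ℝ}
    (hg : Integrable g ρ) (hw : Integrable w ρ) (hgw : Integrable (fun x => g x * w x) ρ) :
    Integrable (fun p : ℝ × ℝ => (g p.1 - g p.2) * (w p.1 - w p.2)) (ρ.prod ρ) := by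
  have i1 : Integrable (fun p : ℝ × ℝ => g p.1 * w p.1) (ρ.prod ρ) := hgw.comp_fst ρ
  have i2 : Integrable (fun p : ℝ × ℝ => g p.2 * w p.2) (ρ.prod ρ) := hgw.comp_snd ρ
  have i3 : Integrable (fun p : ℝ × ℝ => g p.1 * w p.2) (ρ.prod ρ) := hg.mul_prod hw
  have i4 : Integrable (fun p : ℝ × ℝ => w p.1 * g p.2) (ρ.prod ρ) := hw.mul_prod hg
  refine (((i1.sub i3).sub i4).add i2).congr (ae_of_all _ fun p => ?_)
  simp only [Pi.add_apply, Pi.sub_apply]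
  ring

theorem integral_prod_sub_mul_sub {ρ : Measure ℝ} [IsFiniteMeasure ρ] {g w : ℝ → ℝ}
    (hg : Integrable g ρ) (hw : Integrable w ρ) (hgw : Integrable (fun x => g x * w x) ρ) :
    ∫ p : ℝ × ℝ, (g p.1 - g p.2) * (w p.1 - w p.2) ∂(ρ.prod ρ) =
      2 * ((∫ y, g y * w y ∂ρ) * ρ.real Set.univ - (∫ y, g y ∂ρ) * ∫ y, w y ∂ρ) := by
  rw [integral_prod _ (integrable_sub_mul_sub_prod hg hw hgw)]
  simp only
  simp_rw [integral_sub_mul_sub hg hw hgw]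
  have i0 := hgw.mul_const (ρ.real Set.univ)
  have i1 := hg.mul_const (∫ y, w y ∂ρ)
  have i2 := hw.mul_const (∫ y, g y ∂ρ)
  have i01 : Integrable (fun x => g x * w x * ρ.real Set.univ - g x * ∫ y, w y ∂ρ) ρ := i0.sub i1
  have i012 : Integrable (fun x => g x * w x * ρ.real Set.univ - g x * ∫ y, w y ∂ρ -
      w x * ∫ y, g y ∂ρ) ρ := i01.sub i2
  rw [integral_add i012 (integrable_const _), integral_sub i01 i2,
    integral_sub i0 i1, integral_mul_const, integral_mul_const, integral_mul_const, integral_const]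
  simp only [smul_eq_mul]
  ring

/-- The exceptional set is upward closed: either it has a least element, or it is covered by
countably many null half-lines with rational endpoints. -/
theorem ae_measure_Ici_ne_zero (μ : Measure ℝ) : ∀ᵐ x ∂μ, μ (Set.Ici x) ≠ 0 := by
  rw [ae_iff]
  simp only [not_not, ne_eq]
  set U := {x : ℝ | μ (Set.Ici x) = 0} with hU
  have hup : ∀ x ∈ U, ∀ y, x ≤ y → y ∈ U := fun x hx y hxy =>
    measure_mono_null (Set.Ici_subset_Ici.mpr hxy) hx
  by_cases hmin : ∃ a ∈ U, ∀ x ∈ U, a ≤ x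
  · obtain ⟨a, ha, hax⟩ := hmin
    exact measure_mono_null (fun x hx => hax x hx) ha
  · push Not at hmin
    have hsub : U ⊆ ⋃ q : {q : ℚ // (q : ℝ) ∈ U}, Set.Ici ((q : ℚ) : ℝ) := by
      intro x hx
      obtain ⟨y, hy, hyx⟩ := hmin x hx
      obtain ⟨q, hq1, hq2⟩ := exists_rat_btwn hyx
      exact Set.mem_iUnion.mpr ⟨⟨q, hup y hy q hq1.le⟩, hq2.le⟩
    exact measure_mono_null hsub (measure_iUnion_null fun q => q.2)

/-- If `g x = E[g(Y) | Y > x]` for almost every `x`, then `g` is almost everywhere constant. -/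
theorem ae_eq_integral_of_tail_average {μ : Measure ℝ} [IsProbabilityMeasure μ] {g : ℝ → ℝ}
    (hg : Integrable g μ)
    (h : ∀ᵐ x ∂μ, g x * μ.real (Set.Ioi x) = ∫ y in Set.Ioi x, g y ∂μ) :
    ∀ᵐ x ∂μ, g x = ∫ y, g y ∂μ := by
  set c := ∫ y, g y ∂μ with hc
  have hh : Integrable (fun x => g x - c) μ := hg.sub (integrable_const c)
  have h0 : ∫ x, (g x - c) ∂μ = 0 := by
    rw [integral_sub hg (integrable_const c)]; simp [hc]
  -- The double integral of `(g x - c) * (g y - c)` is the square of a mean that vanishes. By the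
  -- tail-average hypothesis it also equals the integral of `(g x - c) ^ 2 * (2 μ(x, ∞) + μ{x})`,
  -- whose weight is positive almost everywhere.
  obtain ⟨i1, i2, e⟩ := integral_prod_eq_of_symm (hh.mul_prod hh) (fun x y => mul_comm _ _)
  rw [integral_prod_mul (fun x => g x - c) (fun x => g x - c), h0, mul_zero] at e
  simp only at i1 i2 e
  have hH : ∀ᵐ x ∂μ, ∫ y in Set.Ioi x, (g x - c) * (g y - c) ∂μ =
      (g x - c) ^ 2 * μ.real (Set.Ioi x) := by
    filter_upwards [h] with x hx
    rw [integral_const_mul, integral_sub hg.integrableOn (integrable_const c), ← hx]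
    simp
    ring
  rw [← integral_const_mul, ← integral_add (i1.const_mul 2) i2] at e
  have hz := (integral_eq_zero_iff_of_nonneg_ae ?_ ((i1.const_mul 2).add i2)).mp e.symm
  · filter_upwards [hz, hH, ae_measure_Ici_ne_zero μ] with x hx1 hx2 hx3
    simp only [Pi.add_apply, Pi.zero_apply, hx2] at hx1
    by_contra hne
    have hpos : 0 < (g x - c) ^ 2 := by
      have : g x - c ≠ 0 := sub_ne_zero.mpr hne
      positivity
    have hsplit : μ.real (Set.Ici x) ≤ μ.real {x} + μ.real (Set.Ioi x) := by
      rw [← Set.Ioi_insert, Set.insert_eq]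
      exact measureReal_union_le _ _
    have hI : 0 < μ.real (Set.Ici x) :=
      ENNReal.toReal_pos hx3 (measure_ne_top _ _)
    have a1 : 0 ≤ μ.real {x} := measureReal_nonneg
    have a2 : 0 ≤ μ.real (Set.Ioi x) := measureReal_nonneg
    have : 0 < (g x - c) ^ 2 * (2 * μ.real (Set.Ioi x) + μ.real {x}) := by
      refine mul_pos hpos ?_
      linarith
    linarith
  · filter_upwards [hH] with x hx
    simp only [Pi.add_apply, Pi.zero_apply, hx]
    have a1 : 0 ≤ μ.real {x} := measureReal_nonneg
    have a2 : 0 ≤ μ.real (Set.Ioi x) := measureReal_nonneg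
    have := mul_self_nonneg (g x - c)
    positivity

/-- If on every upper tail `g` is uncorrelated with the strictly increasing weight `w`,
then `g` is almost everywhere constant. -/
theorem ae_eq_integral_of_tail_uncorrelated {μ : Measure ℝ} [IsProbabilityMeasure μ] {g w : ℝ → ℝ}
    (hμ : ∀ᵐ x ∂μ, 0 < x) (hw_mono : StrictMonoOn w (Set.Ioi 0))
    (hg : Integrable g μ) (hw : Integrable w μ) (hgw : Integrable (fun x => g x * w x) μ)
    (h : ∀ s, (∫ x in Set.Ioi s, g x * w x ∂μ) * μ.real (Set.Ioi s) =
      (∫ x in Set.Ioi s, g x ∂μ) * ∫ x in Set.Ioi s, w x ∂μ) :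
    ∀ᵐ x ∂μ, g x = ∫ y, g y ∂μ := by
  -- Symmetrised covariance: over `(s, ∞) ^ 2` the integrand has integral zero by `h s`, and it
  -- vanishes on the diagonal. So the triangle integral is zero for every `s`, which localises to
  -- almost every `x`.
  have hΦ : (fun x => ∫ y in Set.Ioi x, (g x - g y) * (w x - w y) ∂μ) =ᵐ[μ] 0 := by
    apply ae_eq_zero_of_forall_setIntegral_Ioi_eq_zero
    · exact (integral_prod_eq_of_symm (integrable_sub_mul_sub_prod hg hw hgw)
        (fun x y => by ring)).1
    · intro s
      obtain ⟨-, -, e⟩ := integral_prod_eq_of_symm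
        (integrable_sub_mul_sub_prod (ρ := μ.restrict (Set.Ioi s)) hg.integrableOn hw.integrableOn
          hgw.integrableOn) (fun x y => by ring)
      rw [integral_prod_sub_mul_sub hg.integrableOn hw.integrableOn hgw.integrableOn] at e
      simp only [sub_self, mul_zero, integral_zero, add_zero, measureReal_restrict_apply_univ,
        h s] at e
      have e' : ∫ x in Set.Ioi s, ∫ y in Set.Ioi x, (g x - g y) * (w x - w y)
          ∂(μ.restrict (Set.Ioi s)) ∂μ = 0 := by linarith
      rw [← e']
      refine setIntegral_congr_fun measurableSet_Ioi fun x hx => ?_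
      rw [Measure.restrict_restrict measurableSet_Ioi,
        Set.inter_eq_left.mpr (Set.Ioi_subset_Ioi (le_of_lt hx))]
  refine ae_eq_integral_of_tail_average hg ?_
  filter_upwards [hΦ, hμ] with x hx hx0
  simp only [Pi.zero_apply] at hx
  rw [integral_sub_mul_sub hg.integrableOn hw.integrableOn hgw.integrableOn] at hx
  simp only [measureReal_restrict_apply_univ] at hx
  by_cases hM : μ (Set.Ioi x) = 0
  · rw [Measure.restrict_eq_zero.mpr hM]
    simp [measureReal_def, hM]
  · have hpos : 0 < ∫ y in Set.Ioi x, (w y - w x) ∂μ := by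
      rw [setIntegral_pos_iff_support_of_nonneg_ae]
      · refine lt_of_lt_of_le (pos_iff_ne_zero.mpr hM) (measure_mono fun y hy => ⟨?_, hy⟩)
        exact (sub_pos.mpr (hw_mono hx0 (lt_trans hx0 hy) hy)).ne'
      · refine (ae_restrict_iff' measurableSet_Ioi).mpr (ae_of_all _ fun y hy => ?_)
        exact (sub_pos.mpr (hw_mono hx0 (lt_trans hx0 hy) hy)).le
      · exact (hw.sub (integrable_const _)).integrableOn
    rw [integral_sub hw.integrableOn (integrable_const _)] at hpos
    simp only [integral_const, measureReal_restrict_apply_univ, smul_eq_mul] at hpos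
    have hMpos : 0 < μ.real (Set.Ioi x) := ENNReal.toReal_pos hM (measure_ne_top _ _)
    have hs := h x
    set M := μ.real (Set.Ioi x)
    set A := ∫ y in Set.Ioi x, g y ∂μ
    set B := ∫ y in Set.Ioi x, w y ∂μ
    set C := ∫ y in Set.Ioi x, g y * w y ∂μ
    -- The localised identity and the hypothesis at `s = x` factor. Strict monotonicity makes the
    -- second factor positive, so `g x` is the average of `g` over `(x, ∞)`.
    have key : (g x * M - A) * (B - M * w x) = 0 := by linear_combination hs - M * hx
    rcases mul_eq_zero.mp key with hk | hk
    · linarith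
    · exact absurd hk hpos.ne'

variable {Ω : Type*} {n : ℕ}

/-! ### Tail identities -/

/-- Write `E[V | S] = g(S)`. The tail hypothesis passes to `g` under the law of `S`, where `g` must
be constant. -/
theorem integral_mul_comp_of_tail_uncorrelated [MeasurableSpace Ω] {P : Measure Ω}
    [IsProbabilityMeasure P]
    {S V : Ω → ℝ} {w : ℝ → ℝ} (hS : Measurable S) (hpos : ∀ᵐ ω ∂P, 0 < S ω)
    (hwm : Measurable w) (hw_mono : StrictMonoOn w (Set.Ioi 0))
    (hV : Integrable V P) (hw : Integrable (fun ω => w (S ω)) P)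
    (hVw : Integrable (fun ω => V ω * w (S ω)) P)
    (h : ∀ s, (∫ ω in S ⁻¹' Set.Ioi s, V ω * w (S ω) ∂P) * P.real (S ⁻¹' Set.Ioi s) =
      (∫ ω in S ⁻¹' Set.Ioi s, V ω ∂P) * ∫ ω in S ⁻¹' Set.Ioi s, w (S ω) ∂P)
    {ψ : ℝ → ℝ} (hψ : Measurable ψ) (hVψ : Integrable (fun ω => V ω * ψ (S ω)) P) :
    ∫ ω, V ω * ψ (S ω) ∂P = (∫ ω, V ω ∂P) * ∫ ω, ψ (S ω) ∂P := by
  have hle : MeasurableSpace.comap S inferInstance ≤ (inferInstance : MeasurableSpace Ω) :=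
    hS.comap_le
  obtain ⟨g, hgm, hg⟩ := (stronglyMeasurable_condExp (f := V) (μ := P)
    (m := MeasurableSpace.comap S inferInstance)).exists_eq_measurable_comp
  have hgint : Integrable (fun ω => g (S ω)) P := by
    have := integrable_condExp (f := V) (μ := P) (m := MeasurableSpace.comap S inferInstance)
    rwa [hg] at this
  have hpull : ∀ φ : ℝ → ℝ, Measurable φ → Integrable (fun ω => V ω * φ (S ω)) P →
      Integrable (fun ω => g (S ω) * φ (S ω)) P ∧ ∀ s, MeasurableSet s →
        ∫ ω in S ⁻¹' s, V ω * φ (S ω) ∂P = ∫ ω in S ⁻¹' s, g (S ω) * φ (S ω) ∂P := by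
    intro φ hφ hVφ
    have hφS : StronglyMeasurable[MeasurableSpace.comap S inferInstance] (fun ω => φ (S ω)) :=
      (hφ.comp (comap_measurable S)).stronglyMeasurable
    have e := condExp_mul_of_stronglyMeasurable_right hφS hVφ hV
    rw [hg] at e
    refine ⟨integrable_condExp.congr e, fun s hs => ?_⟩
    rw [← setIntegral_condExp hle hVφ ⟨s, hs, rfl⟩]
    exact integral_congr_ae (ae_restrict_of_ae e)
  have hV1 : ∀ s, MeasurableSet s →
      ∫ ω in S ⁻¹' s, V ω ∂P = ∫ ω in S ⁻¹' s, g (S ω) ∂P := fun s hs => by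
    simpa using (hpull (fun _ => 1) measurable_const (by simpa using hV)).2 s hs
  have hprob : IsProbabilityMeasure (P.map S) := Measure.isProbabilityMeasure_map hS.aemeasurable
  have hae := ae_eq_integral_of_tail_uncorrelated (μ := P.map S) (g := g) (w := w)
    ((ae_map_iff hS.aemeasurable measurableSet_Ioi).mpr hpos) hw_mono
    ((integrable_map_measure hgm.aestronglyMeasurable hS.aemeasurable).mpr hgint)
    ((integrable_map_measure hwm.aestronglyMeasurable hS.aemeasurable).mpr hw)
    ((integrable_map_measure (hgm.mul hwm.stronglyMeasurable).aestronglyMeasurable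
      hS.aemeasurable).mpr (hpull w hwm hVw).1) (fun s => by
      have hmul : AEStronglyMeasurable (fun x => g x * w x) (P.map S) :=
        (hgm.mul hwm.stronglyMeasurable).aestronglyMeasurable
      rw [setIntegral_map measurableSet_Ioi hmul hS.aemeasurable,
        setIntegral_map measurableSet_Ioi hgm.aestronglyMeasurable hS.aemeasurable,
        setIntegral_map measurableSet_Ioi hwm.aestronglyMeasurable hS.aemeasurable,
        map_measureReal_apply hS measurableSet_Ioi, ← hV1 _ measurableSet_Ioi, ← h s,
        (hpull w hwm hVw).2 _ measurableSet_Ioi])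
  rw [integral_map hS.aemeasurable hgm.aestronglyMeasurable] at hae
  have hc : ∫ ω, g (S ω) ∂P = ∫ ω, V ω ∂P := by
    simpa using (hV1 Set.univ MeasurableSet.univ).symm
  have hae' := ae_of_ae_map hS.aemeasurable hae
  have := (hpull ψ hψ hVψ).2 Set.univ MeasurableSet.univ
  simp only [Set.preimage_univ, Measure.restrict_univ] at this
  rw [this, ← integral_const_mul]
  refine integral_congr_ae ?_
  filter_upwards [hae'] with ω hω
  rw [hω, hc]

/-- The quantile `v` at level `P(S ≤ s)` may lie below `s`, but right continuity of the distribution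
function leaves no mass in `(v, s]`. Thus every threshold `s ≥ 0` is realised by some level. -/
theorem valueAtRisk_tail [MeasurableSpace Ω] {P : Measure Ω} [IsProbabilityMeasure P] {S : Ω → ℝ}
    (hS : Measurable S)
    {s : ℝ} (hs : 0 ≤ s) :
    {ω | valueAtRisk P S (P.real {ω | S ω ≤ s}) < S ω} =ᵐ[P] S ⁻¹' Set.Ioi s := by
  set q := P.real {ω | S ω ≤ s} with hq
  set v := valueAtRisk P S q with hv
  have hmono : ∀ a b, a ≤ b → P.real {ω | S ω ≤ a} ≤ P.real {ω | S ω ≤ b} := fun a b hab =>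
    measureReal_mono fun ω (hω : S ω ≤ a) => le_trans hω hab
  have hbdd : BddBelow {u : ℝ | 0 ≤ u ∧ q ≤ P.real {ω | S ω ≤ u}} := ⟨0, fun u hu => hu.1⟩
  have hmem : s ∈ {u : ℝ | 0 ≤ u ∧ q ≤ P.real {ω | S ω ≤ u}} := ⟨hs, le_rfl⟩
  have hvs : v ≤ s := csInf_le hbdd hmem
  have hprob : IsProbabilityMeasure (P.map S) := Measure.isProbabilityMeasure_map hS.aemeasurable
  have hcdf : ∀ u, cdf (P.map S) u = P.real {ω | S ω ≤ u} := fun u => by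
    rw [cdf_eq_real, map_measureReal_apply hS measurableSet_Iic]; rfl
  have hqv : q ≤ P.real {ω | S ω ≤ v} := by
    rw [← hcdf]
    have ht := ((cdf (P.map S)).right_continuous v).tendsto.mono_left
      (nhdsWithin_mono v Set.Ioi_subset_Ici_self)
    refine ge_of_tendsto ht ?_
    filter_upwards [self_mem_nhdsWithin] with u hu
    obtain ⟨u', hu', hlt⟩ := exists_lt_of_csInf_lt ⟨s, hmem⟩ hu
    rw [hcdf]
    exact hu'.2.trans (hmono _ _ hlt.le)
  have hsub : {ω | S ω ≤ v} ⊆ {ω | S ω ≤ s} := fun ω (hω : S ω ≤ v) => le_trans hω hvs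
  have hae : ({ω | S ω ≤ v} : Set Ω) =ᵐ[P] {ω | S ω ≤ s} := by
    refine ae_eq_of_subset_of_measure_ge hsub ?_
      (measurableSet_le hS measurable_const).nullMeasurableSet (measure_ne_top _ _)
    exact (ENNReal.toReal_le_toReal (measure_ne_top _ _) (measure_ne_top _ _)).mp hqv
  have := hae.compl
  simpa only [Set.compl_def, Set.mem_ofPred_eq, not_le, Set.preimage, Set.mem_Ioi] using this

/-! ### Elementary properties of the aggregate and the ratios. -/

theorem measurable_aggregate [MeasurableSpace Ω] {X : Fin n → Ω → ℝ} (hX : ∀ i, Measurable (X i)) :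
    Measurable (aggregate X) := Finset.measurable_sum _ fun i _ => hX i

theorem measurable_ratio [MeasurableSpace Ω] {X : Fin n → Ω → ℝ} (hX : ∀ i, Measurable (X i))
    (i : Fin n) :
    Measurable (ratio X i) := (hX i).div (measurable_aggregate hX)

theorem ae_all_pos [MeasurableSpace Ω] {P : Measure Ω} {X : Fin n → Ω → ℝ}
    (hX : ∀ i, IsLoss P (X i)) :
    ∀ᵐ ω ∂P, ∀ i, 0 < X i ω := ae_all_iff.mpr fun i => (hX i).2

theorem aggregate_pos {X : Fin n → Ω → ℝ} {ω : Ω} (h : ∀ i, 0 < X i ω) (i : Fin n) :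
    0 < aggregate X ω := Finset.sum_pos (fun j _ => h j) ⟨i, Finset.mem_univ i⟩

theorem ratio_pos {X : Fin n → Ω → ℝ} {ω : Ω} (h : ∀ i, 0 < X i ω) (i : Fin n) :
    0 < ratio X i ω := div_pos (h i) (aggregate_pos h i)

theorem ratio_le_one {X : Fin n → Ω → ℝ} {ω : Ω} (h : ∀ i, 0 < X i ω) (i : Fin n) :
    ratio X i ω ≤ 1 := by
  rw [ratio, div_le_one (aggregate_pos h i)]
  exact Finset.single_le_sum (f := fun j => X j ω) (fun j _ => (h j).le) (Finset.mem_univ i)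

theorem ratio_lt_one (hn : 2 ≤ n) {X : Fin n → Ω → ℝ} {ω : Ω} (h : ∀ i, 0 < X i ω) (i : Fin n) :
    ratio X i ω < 1 := by
  rw [ratio, div_lt_one (aggregate_pos h i)]
  have : Nontrivial (Fin n) := Fin.nontrivial_iff_two_le.mpr hn
  obtain ⟨j, hj⟩ := exists_ne i
  exact Finset.single_lt_sum (f := fun j => X j ω) hj (Finset.mem_univ i) (Finset.mem_univ j) (h j)
    (fun k _ _ => (h k).le)

theorem ratio_mul_aggregate {X : Fin n → Ω → ℝ} {ω : Ω} (h : ∀ i, 0 < X i ω) (i : Fin n) :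
    ratio X i ω * aggregate X ω = X i ω := div_mul_cancel₀ _ (aggregate_pos h i).ne'

theorem tailExp_eq [MeasurableSpace Ω] {P : Measure Ω} {X : Fin n → Ω → ℝ} {q : ℝ} {A : Set Ω}
    (hA : tailEvent P X q =ᵐ[P] A) (Y : Ω → ℝ) :
    tailExp P X q Y = (P.real A)⁻¹ * ∫ ω in A, Y ω ∂P := by
  rw [tailExp, ProbabilityTheory.cond, measure_congr hA, Measure.restrict_congr_set hA,
    integral_smul_measure]
  simp [measureReal_def]

theorem ae_norm_ratio_pow_le [MeasurableSpace Ω] {P : Measure Ω} {X : Fin n → Ω → ℝ}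
    (hX : ∀ i, IsLoss P (X i))
    (i : Fin n) (k : ℕ) : ∀ᵐ ω ∂P, ‖ratio X i ω ^ k‖ ≤ 1 := by
  filter_upwards [ae_all_pos hX] with ω hω
  rw [norm_pow, Real.norm_of_nonneg (ratio_pos hω i).le]
  exact pow_le_one₀ (ratio_pos hω i).le (ratio_le_one hω i)

theorem memLp_aggregate [MeasurableSpace Ω] {P : Measure Ω} {X : Fin n → Ω → ℝ} {p : ENNReal}
    (hX : ∀ i, MemLp (X i) p P) : MemLp (aggregate X) p P := memLp_finsetSum _ fun i _ => hX i

theorem integrable_aggregate_pow [MeasurableSpace Ω] {P : Measure Ω} [IsFiniteMeasure P]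
    {X : Fin n → Ω → ℝ} {k : ℕ}
    (hX : ∀ i, IsLoss P (X i)) (h : ∀ i, MemLp (X i) k P) :
    Integrable (fun ω => aggregate X ω ^ k) P := by
  have := (memLp_aggregate h).integrable_norm_pow'
  refine this.congr ?_
  filter_upwards [ae_all_pos hX] with ω hω
  rw [Real.norm_of_nonneg]
  exact Finset.sum_nonneg fun i _ => (hω i).le

/-- For a portfolio in `𝔚_k`, `E[R_i ^ k | S_X]` is constant. -/
theorem integral_ratio_pow_mul_of_mem_frakW [MeasurableSpace Ω] {P : Measure Ω}
    [IsProbabilityMeasure P]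
    {X : Fin n → Ω → ℝ} {k : ℕ} (hk : k ≠ 0) (hX : X ∈ frakW P n k) (i : Fin n)
    {ψ : ℝ → ℝ} (hψ : Measurable ψ) (hint : Integrable (fun ω => ψ (aggregate X ω)) P) :
    ∫ ω, ratio X i ω ^ k * ψ (aggregate X ω) ∂P =
      (∫ ω, ratio X i ω ^ k ∂P) * ∫ ω, ψ (aggregate X ω) ∂P := by
  obtain ⟨hX1, hX2⟩ := hX
  have hL := fun i => (hX1 i).1
  have hS := measurable_aggregate fun i => (hL i).1
  have hRm : Measurable (fun ω => ratio X i ω ^ k) :=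
    (measurable_ratio (fun i => (hL i).1) i).pow_const k
  have hRb := ae_norm_ratio_pow_le hL i k
  have hpos : ∀ᵐ ω ∂P, 0 < aggregate X ω := (ae_all_pos hL).mono fun ω hω => aggregate_pos hω i
  have hSk := integrable_aggregate_pow hL fun i => (hX1 i).2
  have hV : Integrable (fun ω => ratio X i ω ^ k) P := Integrable.of_bound hRm.aestronglyMeasurable
    1 hRb
  have hXR : (fun ω => X i ω ^ k) =ᵐ[P] fun ω => ratio X i ω ^ k * aggregate X ω ^ k := by
    filter_upwards [ae_all_pos hL] with ω hω
    rw [← mul_pow, ratio_mul_aggregate hω]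
  refine integral_mul_comp_of_tail_uncorrelated (w := fun x => x ^ k) hS hpos (by fun_prop)
    (fun x hx y _ hxy => pow_lt_pow_left₀ hxy (le_of_lt hx) hk) hV hSk
    (hSk.bdd_mul hRm.aestronglyMeasurable hRb) ?_ hψ (hint.bdd_mul hRm.aestronglyMeasurable hRb)
  have key : ∀ s, 0 ≤ s →
      (∫ ω in aggregate X ⁻¹' Set.Ioi s, ratio X i ω ^ k * aggregate X ω ^ k ∂P) *
        P.real (aggregate X ⁻¹' Set.Ioi s) =
      (∫ ω in aggregate X ⁻¹' Set.Ioi s, ratio X i ω ^ k ∂P) *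
        ∫ ω in aggregate X ⁻¹' Set.Ioi s, aggregate X ω ^ k ∂P := by
    intro s hs
    rw [← integral_congr_ae (ae_restrict_of_ae hXR)]
    have hev := valueAtRisk_tail (P := P) hS hs
    set q := P.real {ω | aggregate X ω ≤ s} with hq
    set A := aggregate X ⁻¹' Set.Ioi s with hA
    have hAm : MeasurableSet A := hS measurableSet_Ioi
    by_cases h0 : P A = 0
    · rw [Measure.restrict_eq_zero.mpr h0]
      simp
    have hAc : A = {ω | aggregate X ω ≤ s}ᶜ := by ext ω; simp [hA]
    have hApos : 0 < P.real A := ENNReal.toReal_pos h0 (measure_ne_top _ _)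
    have hq1 : q < 1 := by
      rw [hAc, probReal_compl_eq_one_sub (measurableSet_le hS measurable_const)] at hApos
      linarith
    have hev' : tailEvent P X q =ᵐ[P] A := hev
    have := hX2 q ⟨measureReal_nonneg, hq1⟩ (by
      rw [measure_congr hev']; exact pos_iff_ne_zero.mpr h0) i
    rw [propAlloc, ratioAlloc, tailExp_eq hev', tailExp_eq hev', tailExp_eq hev'] at this
    have hSpos : 0 < ∫ ω in A, aggregate X ω ^ k ∂P := by
      rw [setIntegral_pos_iff_support_of_nonneg_ae]
      · refine lt_of_lt_of_le (pos_iff_ne_zero.mpr h0) (measure_mono fun ω hω => ⟨?_, hω⟩)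
        exact (pow_pos (lt_of_le_of_lt hs hω) k).ne'
      · exact ae_restrict_of_ae (hpos.mono fun ω hω => (pow_pos hω k).le)
      · exact hSk.integrableOn
    field_simp at this
    linarith
  intro s
  rcases le_total 0 s with hs | hs
  · exact key s hs
  -- Quantiles are nonnegative by definition; negative thresholds reduce to `0` because the
  -- aggregate is almost surely positive.
  · have hae : aggregate X ⁻¹' Set.Ioi s =ᵐ[P] aggregate X ⁻¹' Set.Ioi 0 := by
      filter_upwards [hpos] with ω hω
      exact propext ⟨fun _ => hω, fun _ => lt_of_le_of_lt hs hω⟩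
    rw [Measure.restrict_congr_set hae, measureReal_congr hae]
    exact key 0 le_rfl

/-! ### Moment generating functions on the negative half-line -/

theorem mem_interior_integrableExpSet_of_neg [MeasurableSpace Ω] {P : Measure Ω}
    [IsProbabilityMeasure P] {Y : Ω → ℝ} (hY : IsLoss P Y) {t : ℝ} (ht : t < 0) :
    t ∈ interior (integrableExpSet Y P) := by
  refine mem_interior.mpr ⟨Set.Iio 0, fun u hu => ?_, isOpen_Iio, ht⟩
  refine Integrable.of_bound (by have := hY.1; fun_prop) 1 ?_
  filter_upwards [hY.2] with ω hω
  rw [Real.norm_of_nonneg (Real.exp_pos _).le, Real.exp_le_one_iff]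
  exact mul_nonpos_of_nonpos_of_nonneg (le_of_lt hu) hω.le

theorem mgf_pos_of_neg [MeasurableSpace Ω] {P : Measure Ω} [IsProbabilityMeasure P] {Y : Ω → ℝ}
    (hY : IsLoss P Y) {t : ℝ} (ht : t < 0) : 0 < mgf Y P t := by
  have hi : t ∈ integrableExpSet Y P :=
    interior_subset (mem_interior_integrableExpSet_of_neg hY ht)
  exact mgf_pos hi

/-- Fixes the constant of integration later on. The limit is one-sided since exponential moments are
available only for `t ≤ 0`. -/
theorem tendsto_mgf_zero_left [MeasurableSpace Ω] {P : Measure Ω} [IsProbabilityMeasure P]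
    {Y : Ω → ℝ} (hY : IsLoss P Y) :
    Filter.Tendsto (mgf Y P) (nhdsWithin 0 (Set.Iio 0)) (nhds 1) := by
  have h : Filter.Tendsto (fun t => ∫ ω, Real.exp (t * Y ω) ∂P) (nhdsWithin 0 (Set.Iio 0))
      (nhds (∫ _, (1 : ℝ) ∂P)) := by
    refine tendsto_integral_filter_of_dominated_convergence (fun _ => 1) ?_ ?_
      (integrable_const 1) ?_
    · refine Filter.Eventually.of_forall fun t => ?_
      have := hY.1
      fun_prop
    · filter_upwards [self_mem_nhdsWithin] with t ht
      filter_upwards [hY.2] with ω hω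
      rw [Real.norm_of_nonneg (Real.exp_pos _).le, Real.exp_le_one_iff]
      exact mul_nonpos_of_nonpos_of_nonneg (le_of_lt ht) hω.le
    · refine ae_of_all _ fun ω => ?_
      have hc : Continuous fun t : ℝ => Real.exp (t * Y ω) := by fun_prop
      have := (hc.tendsto 0).mono_left (nhdsWithin_le_nhds (s := Set.Iio 0))
      simpa using this
  rw [show mgf Y P = fun t => ∫ ω, Real.exp (t * Y ω) ∂P from rfl]
  simpa using h

theorem deriv_cgf_pos_of_neg [MeasurableSpace Ω] {P : Measure Ω} [IsProbabilityMeasure P]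
    {Y : Ω → ℝ} (hY : IsLoss P Y) {t : ℝ} (ht : t < 0) : 0 < deriv (cgf Y P) t := by
  have hint := mem_interior_integrableExpSet_of_neg hY ht
  rw [deriv_cgf hint]
  refine div_pos ?_ (mgf_pos_of_neg hY ht)
  have hi := integrable_pow_mul_exp_of_mem_interior_integrableExpSet hint 1
  simp only [pow_one] at hi
  have hp : ∀ᵐ ω ∂P, 0 < Y ω * Real.exp (t * Y ω) :=
    hY.2.mono fun ω hω => mul_pos hω (Real.exp_pos _)
  rw [integral_pos_iff_support_of_nonneg_ae (hp.mono fun ω hω => hω.le) hi]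
  refine lt_of_lt_of_le (b := P Set.univ) (by simp) (measure_mono_ae ?_)
  filter_upwards [hp] with ω hω _ using hω.ne'

/-- The second derivative is the variance under the law tilted by `exp (t Y)`, which has the same
null sets as `P`. -/
theorem deriv_deriv_cgf_pos_of_neg [MeasurableSpace Ω] {P : Measure Ω} [IsProbabilityMeasure P]
    {Y : Ω → ℝ} (hY : IsLoss P Y) (hnc : ¬ ∃ c : ℝ, ∀ᵐ ω ∂P, Y ω = c) {t : ℝ} (ht : t < 0) :
    0 < deriv (deriv (cgf Y P)) t := by
  have hint := mem_interior_integrableExpSet_of_neg hY ht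
  have h2 : deriv (deriv (cgf Y P)) t = iteratedDeriv 2 (cgf Y P) t := by
    rw [iteratedDeriv_succ, iteratedDeriv_one]
  rw [h2, iteratedDeriv_two_cgf_eq_integral hint]
  set m := deriv (cgf Y P) t
  refine div_pos ?_ (mgf_pos_of_neg hY ht)
  have i0 := integrable_pow_mul_exp_of_mem_interior_integrableExpSet hint 0
  have i1 := integrable_pow_mul_exp_of_mem_interior_integrableExpSet hint 1
  have i2 := integrable_pow_mul_exp_of_mem_interior_integrableExpSet hint 2
  have hi : Integrable (fun ω => (Y ω - m) ^ 2 * Real.exp (t * Y ω)) P := by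
    refine ((i2.sub (i1.const_mul (2 * m))).add (i0.const_mul (m ^ 2))).congr
      (ae_of_all _ fun ω => ?_)
    simp only [Pi.add_apply, Pi.sub_apply]
    ring
  have hnn : 0 ≤ᵐ[P] fun ω => (Y ω - m) ^ 2 * Real.exp (t * Y ω) := ae_of_all _ fun ω => by
    simp only [Pi.zero_apply]; positivity
  refine lt_of_le_of_ne (integral_nonneg_of_ae hnn) fun h0 => hnc ⟨m, ?_⟩
  filter_upwards [(integral_eq_zero_iff_of_nonneg_ae hnn hi).mp h0.symm] with ω hω
  simp only [Pi.zero_apply, mul_eq_zero, (Real.exp_pos _).ne', or_false] at hω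
  exact sub_eq_zero.mp (pow_eq_zero_iff two_ne_zero |>.mp hω)

theorem hasDerivAt_cgf_of_neg [MeasurableSpace Ω] {P : Measure Ω} [IsProbabilityMeasure P]
    {Y : Ω → ℝ} (hY : IsLoss P Y) {t : ℝ} (ht : t < 0) :
    HasDerivAt (cgf Y P) (deriv (cgf Y P) t) t :=
  (analyticAt_cgf (mem_interior_integrableExpSet_of_neg hY ht)).differentiableAt.hasDerivAt

theorem hasDerivAt_deriv_cgf_of_neg [MeasurableSpace Ω] {P : Measure Ω} [IsProbabilityMeasure P]
    {Y : Ω → ℝ} (hY : IsLoss P Y) {t : ℝ} (ht : t < 0) :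
    HasDerivAt (deriv (cgf Y P)) (deriv (deriv (cgf Y P)) t) t :=
  (analyticAt_cgf (mem_interior_integrableExpSet_of_neg hY ht)).deriv.differentiableAt.hasDerivAt

/-! ### Differential equations on the negative half-line. -/

theorem exists_eq_const_of_hasDerivAt_zero {f : ℝ → ℝ} (hf : ∀ t < 0, HasDerivAt f 0 t) :
    ∃ C, ∀ t < 0, f t = C :=
  ⟨f (-1), fun _ ht => isOpen_Iio.is_const_of_deriv_eq_zero isPreconnected_Iio
    (fun u hu => (hf u hu).differentiableAt.differentiableWithinAt)
    (fun u hu => (hf u hu).deriv) ht (by simp : (-1 : ℝ) ∈ Set.Iio 0)⟩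

/-- The Riccati equation `m' = κ m ^ 2` has the solutions `1 / (b - κ t)`. -/
theorem exists_inv_eq_of_riccati {m : ℝ → ℝ} {κ : ℝ} (hpos : ∀ t < 0, 0 < m t)
    (hm : ∀ t < 0, HasDerivAt m (κ * m t ^ 2) t) :
    ∃ b, ∀ t < 0, (m t)⁻¹ = b - κ * t := by
  obtain ⟨b, hb⟩ := exists_eq_const_of_hasDerivAt_zero (f := fun t => (m t)⁻¹ + κ * t) (by
    intro t ht
    have h := ((hm t ht).inv (hpos t ht).ne').add ((hasDerivAt_id t).const_mul κ)
    have hne := (hpos t ht).ne'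
    have e : -(κ * m t ^ 2) / m t ^ 2 + κ * 1 = 0 := by
      field_simp
      ring
    rw [e] at h
    exact h)
  exact ⟨b, fun t ht => by linarith [hb t ht]⟩

/-- A positive random variable with `(log E[exp (t Y)])' = γ κ / (b - κ t)` for `t < 0` has a
gamma distribution. -/
theorem hasLaw_gamma_of_deriv_cgf [MeasurableSpace Ω] {P : Measure Ω} [IsProbabilityMeasure P]
    {Y : Ω → ℝ} (hY : IsLoss P Y) {γ κ b : ℝ} (hγ : 0 < γ) (hκ : 0 < κ)
    (hb : ∀ t < 0, 0 < b - κ * t)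
    (hd : ∀ t < 0, HasDerivAt (cgf Y P) (γ * κ * (b - κ * t)⁻¹) t) :
    0 < b ∧ HasLaw Y (gammaMeasure γ (b / κ)) P := by
  obtain ⟨C, hC⟩ := exists_eq_const_of_hasDerivAt_zero
    (f := fun t => cgf Y P t + γ * Real.log (b - κ * t)) (by
    intro t ht
    have h1 : HasDerivAt (fun t => b - κ * t) (-κ) t := by
      simpa using ((hasDerivAt_id t).const_mul κ).const_sub b
    have h := (hd t ht).add ((h1.log (hb t ht).ne').const_mul γ)
    have hne := (hb t ht).ne'
    have e : γ * κ * (b - κ * t)⁻¹ + γ * (-κ / (b - κ * t)) = 0 := by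
      field_simp
      ring
    rw [e] at h
    exact h)
  have hM : ∀ t < 0, mgf Y P t * (b - κ * t) ^ γ = Real.exp C := by
    intro t ht
    have hi := interior_subset (mem_interior_integrableExpSet_of_neg hY ht)
    rw [← hC t ht, Real.exp_add, exp_cgf hi, Real.rpow_def_of_pos (hb t ht), mul_comm γ]
  have hcont : Continuous fun t : ℝ => b - κ * t := by fun_prop
  have hlim0 : Filter.Tendsto (fun t : ℝ => b - κ * t) (nhdsWithin 0 (Set.Iio 0)) (nhds b) := by
    simpa using (hcont.tendsto 0).mono_left (nhdsWithin_le_nhds (s := Set.Iio 0))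
  have hb0 : 0 ≤ b := ge_of_tendsto hlim0 (by
    filter_upwards [self_mem_nhdsWithin] with t ht using (hb t ht).le)
  have hbγ : b ^ γ = Real.exp C := by
    have h1 := (tendsto_mgf_zero_left hY).mul (hlim0.rpow_const (p := γ) (Or.inr hγ.le))
    rw [one_mul] at h1
    refine tendsto_nhds_unique h1 (tendsto_const_nhds.congr' ?_)
    filter_upwards [self_mem_nhdsWithin] with t ht using (hM t ht).symm
  -- Positivity of `b - κ t` for `t < 0` still allows `b = 0`; the limit identity `b ^ γ = exp C`
  -- excludes it.
  have hbpos : 0 < b := by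
    rcases hb0.eq_or_lt with h | h
    · rw [← h, Real.zero_rpow hγ.ne'] at hbγ
      exact absurd hbγ.symm (Real.exp_pos C).ne'
    · exact h
  have hr : 0 < b / κ := div_pos hbpos hκ
  refine ⟨hbpos, ⟨hY.1.aemeasurable, ?_⟩⟩
  have := isProbabilityMeasure_gammaMeasure hγ hr
  have := Measure.isProbabilityMeasure_map (μ := P) hY.1.aemeasurable
  apply ext_of_laplace
  · exact (ae_map_iff hY.1.aemeasurable measurableSet_Ici).mpr (hY.2.mono fun ω hω => hω.le)
  · exact (ae_pos_gammaMeasure _ _).mono fun x hx => hx.le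
  · intro k
    rcases Nat.eq_zero_or_pos k with rfl | hk
    · simp
    · have hk' : (0 : ℝ) < k := Nat.cast_pos.mpr hk
      have ht : -(k : ℝ) < 0 := by linarith
      have h1 := hM _ ht
      have h2 := hb _ ht
      rw [integral_map hY.1.aemeasurable (by fun_prop),
        integral_exp_gammaMeasure hγ hr (by positivity)]
      have h3 : ∫ ω, Real.exp (-(k * Y ω)) ∂P = mgf Y P (-k) := by simp [mgf]
      have h4 : b / κ / (b / κ + k) = b / (b - κ * -k) := by
        have h5 : b + κ * k ≠ 0 := by positivity
        rw [mul_neg, sub_neg_eq_add]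
        field_simp
      rw [h3, h4, Real.div_rpow hb0 h2.le, hbγ, ← h1]
      exact (mul_div_cancel_right₀ _ (Real.rpow_pos_of_pos h2 γ).ne').symm

/-! ### Necessity of the gamma distribution -/

theorem isLoss_aggregate [MeasurableSpace Ω] {P : Measure Ω} {X : Fin n → Ω → ℝ}
    (hX : ∀ i, IsLoss P (X i)) (i : Fin n) : IsLoss P (aggregate X) :=
  ⟨measurable_aggregate fun i => (hX i).1, (ae_all_pos hX).mono fun _ hω => aggregate_pos hω i⟩

/-- The sum of the other losses is independent of `X i` and contributes the same factor to both
sides. The cross-multiplied form needs no sign of `t` and no integrability. -/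
theorem integral_comp_mul_exp_aggregate [MeasurableSpace Ω] {P : Measure Ω}
    {X : Fin n → Ω → ℝ} (hX : ∀ i, Measurable (X i)) (hindep : iIndepFun X P) (i : Fin n)
    {φ : ℝ → ℝ} (hφ : Measurable φ) (t : ℝ) :
    (∫ ω, φ (X i ω) * Real.exp (t * aggregate X ω) ∂P) * mgf (X i) P t =
      (∫ ω, φ (X i ω) * Real.exp (t * X i ω) ∂P) * mgf (aggregate X) P t := by
  set T := ∑ j ∈ Finset.univ.erase i, X j with hT
  have hTm : Measurable T := by
    have : T = fun ω => ∑ j ∈ Finset.univ.erase i, X j ω := by ext ω; simp [hT]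
    rw [this]
    exact Finset.measurable_sum _ fun j _ => hX j
  have hind : IndepFun (X i) T P :=
    (hindep.indepFun_finsetSum_of_notMem hX (Finset.notMem_erase i _)).symm
  have hST : ∀ ω, aggregate X ω = X i ω + T ω := fun ω => by
    rw [aggregate, hT, Finset.sum_apply,
      Finset.add_sum_erase _ (fun j => X j ω) (Finset.mem_univ i)]
  have hfac : ∀ χ : ℝ → ℝ, Measurable χ →
      ∫ ω, χ (X i ω) * Real.exp (t * aggregate X ω) ∂P =
        (∫ ω, χ (X i ω) * Real.exp (t * X i ω) ∂P) * mgf T P t := by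
    intro χ hχ
    have h := hind.integral_comp_mul_comp (f := fun x => χ x * Real.exp (t * x))
      (g := fun x => Real.exp (t * x)) (hX i).aemeasurable hTm.aemeasurable
      (by fun_prop) (by fun_prop)
    simp only [Pi.mul_apply, Function.comp_apply] at h
    rw [mgf, ← h]
    refine integral_congr_ae (ae_of_all _ fun ω => ?_)
    simp only [hST, mul_add, Real.exp_add, mul_assoc]
  have h1 : mgf (aggregate X) P t = mgf (X i) P t * mgf T P t := by
    simpa [mgf] using hfac (fun _ => 1) measurable_const
  rw [hfac φ hφ, h1]
  ring

theorem integral_pow_mul_exp_of_mem_frakW [MeasurableSpace Ω] {P : Measure Ω}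
    [IsProbabilityMeasure P] {X : Fin n → Ω → ℝ} (hindep : iIndepFun X P) {k : ℕ} (hk : k ≠ 0)
    (hX : X ∈ frakW P n k) (i : Fin n) {t : ℝ} (ht : t < 0) :
    (∫ ω, X i ω ^ k * Real.exp (t * X i ω) ∂P) / mgf (X i) P t =
      (∫ ω, ratio X i ω ^ k ∂P) *
        ((∫ ω, aggregate X ω ^ k * Real.exp (t * aggregate X ω) ∂P) / mgf (aggregate X) P t) := by
  have hL := fun i => (hX.1 i).1
  have hSL := isLoss_aggregate hL i
  have hint := integrable_pow_mul_exp_of_mem_interior_integrableExpSet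
    (mem_interior_integrableExpSet_of_neg hSL ht) k
  have h1 := integral_ratio_pow_mul_of_mem_frakW hk hX i
    (ψ := fun x => x ^ k * Real.exp (t * x)) (by fun_prop) hint
  have h2 : ∫ ω, ratio X i ω ^ k * (aggregate X ω ^ k * Real.exp (t * aggregate X ω)) ∂P =
      ∫ ω, X i ω ^ k * Real.exp (t * aggregate X ω) ∂P := by
    refine integral_congr_ae ?_
    filter_upwards [ae_all_pos hL] with ω hω
    rw [← mul_assoc, ← mul_pow, ratio_mul_aggregate hω]
  have h3 := integral_comp_mul_exp_aggregate (fun i => (hL i).1) hindep i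
    (φ := fun x => x ^ k) (by fun_prop) t
  have hM := (mgf_pos_of_neg (hL i) ht).ne'
  have hF := (mgf_pos_of_neg hSL ht).ne'
  rw [← mul_div_assoc, ← h1, h2, div_eq_div_iff hM hF, ← h3]

theorem hasLaw_gamma_of_mem_frakW [MeasurableSpace Ω] {P : Measure Ω} [IsProbabilityMeasure P]
    (hn : 2 ≤ n) {X : Fin n → Ω → ℝ} (hindep : iIndepFun X P)
    (hnondeg : ¬ ∃ c : ℝ, ∀ᵐ ω ∂P, aggregate X ω = c)
    (h1 : X ∈ frakW P n 1) (h2 : X ∈ frakW P n 2) :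
    ∃ θ : ℝ, 0 < θ ∧ ∃ γ : Fin n → ℝ,
      ∀ i, 0 < γ i ∧ HasLaw (X i) (gammaShapeScale (γ i) θ) P := by
  have hL := fun i => (h1.1 i).1
  let i₀ : Fin n := ⟨0, by omega⟩
  have hSL := isLoss_aggregate hL i₀
  set c : Fin n → ℝ := fun i => ∫ ω, ratio X i ω ∂P with hc
  set d := ∫ ω, ratio X i₀ ω ^ 2 ∂P with hd
  have hRint : ∀ i k, Integrable (fun ω => ratio X i ω ^ k) P := fun i k =>
    Integrable.of_bound ((measurable_ratio (fun i => (hL i).1) i).pow_const k).aestronglyMeasurable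
      1 (ae_norm_ratio_pow_le hL i k)
  have hRint1 : ∀ i, Integrable (ratio X i) P := fun i => by simpa using hRint i 1
  have integral_pos' : ∀ f : Ω → ℝ, Integrable f P → (∀ᵐ ω ∂P, 0 < f ω) → 0 < ∫ ω, f ω ∂P := by
    intro f hf hp
    rw [integral_pos_iff_support_of_nonneg_ae (hp.mono fun ω hω => hω.le) hf]
    refine lt_of_lt_of_le (b := P Set.univ) (by simp) (measure_mono_ae ?_)
    filter_upwards [hp] with ω hω _ using hω.ne'
  have hcpos : ∀ i, 0 < c i := fun i => integral_pos' _ (hRint1 i)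
    ((ae_all_pos hL).mono fun ω hω => ratio_pos hω i)
  -- This is `E[R (1 - R)]`, positive because `n ≥ 2` makes the ratio strictly less than one.
  have hcd : 0 < c i₀ - d := by
    rw [hc, hd, ← integral_sub (hRint1 i₀) (hRint i₀ 2)]
    refine integral_pos' _ ((hRint1 i₀).sub (hRint i₀ 2)) ?_
    filter_upwards [ae_all_pos hL] with ω hω
    have := ratio_pos hω i₀
    have := ratio_lt_one hn hω i₀
    nlinarith
  have hl1 : ∀ i, ∀ t < 0, deriv (cgf (X i) P) t = c i * deriv (cgf (aggregate X) P) t := by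
    intro i t ht
    rw [deriv_cgf (mem_interior_integrableExpSet_of_neg (hL i) ht),
      deriv_cgf (mem_interior_integrableExpSet_of_neg hSL ht)]
    simpa using integral_pow_mul_exp_of_mem_frakW hindep one_ne_zero h1 i ht
  have hl1' : ∀ i, ∀ t < 0, deriv (deriv (cgf (X i) P)) t =
      c i * deriv (deriv (cgf (aggregate X) P)) t := by
    intro i t ht
    have he : deriv (cgf (X i) P) =ᶠ[nhds t] fun t => c i * deriv (cgf (aggregate X) P) t :=
      Filter.eventuallyEq_of_mem (isOpen_Iio.mem_nhds ht) (hl1 i)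
    rw [he.deriv_eq]
    exact ((hasDerivAt_deriv_cgf_of_neg hSL ht).const_mul (c i)).deriv
  have hsecond : ∀ Y : Ω → ℝ, IsLoss P Y → ∀ t < 0,
      (∫ ω, Y ω ^ 2 * Real.exp (t * Y ω) ∂P) / mgf Y P t =
        deriv (deriv (cgf Y P)) t + deriv (cgf Y P) t ^ 2 := by
    intro Y hY t ht
    have := iteratedDeriv_two_cgf (mem_interior_integrableExpSet_of_neg hY ht)
    rw [iteratedDeriv_succ, iteratedDeriv_one] at this
    linarith
  have hode : ∀ t < 0, (c i₀ - d) * deriv (deriv (cgf (aggregate X) P)) t =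
      (d - c i₀ ^ 2) * deriv (cgf (aggregate X) P) t ^ 2 := by
    intro t ht
    have := integral_pow_mul_exp_of_mem_frakW hindep two_ne_zero h2 i₀ ht
    rw [hsecond _ (hL i₀) t ht, hsecond _ hSL t ht, hl1 i₀ t ht, hl1' i₀ t ht] at this
    linear_combination this
  have hmpos := fun (t : ℝ) (ht : t < 0) => deriv_cgf_pos_of_neg hSL ht
  set κ := (d - c i₀ ^ 2) / (c i₀ - d) with hκ
  -- Nondegeneracy enters here: `K'' > 0` at one point (any `t < 0` would do) forces `d - c i₀ ^ 2 >
  -- 0`.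
  have hκpos : 0 < κ := by
    refine div_pos ?_ hcd
    have ht : (-1 : ℝ) < 0 := by norm_num
    have a1 := mul_pos hcd (deriv_deriv_cgf_pos_of_neg hSL hnondeg ht)
    rw [hode _ ht] at a1
    exact pos_of_mul_pos_left a1 (sq_nonneg _)
  obtain ⟨b, hb⟩ := exists_inv_eq_of_riccati (m := deriv (cgf (aggregate X) P)) (κ := κ) hmpos (by
    intro t ht
    have e : κ * deriv (cgf (aggregate X) P) t ^ 2 = deriv (deriv (cgf (aggregate X) P)) t := by
      rw [hκ, div_mul_eq_mul_div, ← hode t ht, mul_div_cancel_left₀ _ hcd.ne']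
    rw [e]
    exact hasDerivAt_deriv_cgf_of_neg hSL ht)
  have hbpos : ∀ t < 0, 0 < b - κ * t := fun t ht => by
    rw [← hb t ht]; exact inv_pos.mpr (hmpos t ht)
  have hgam : ∀ i, 0 < b ∧ HasLaw (X i) (gammaMeasure (c i / κ) (b / κ)) P := fun i =>
    hasLaw_gamma_of_deriv_cgf (hL i) (div_pos (hcpos i) hκpos) hκpos hbpos (by
      intro t ht
      rw [← hb t ht, inv_inv, div_mul_cancel₀ _ hκpos.ne', ← hl1 i t ht]
      exact hasDerivAt_cgf_of_neg (hL i) ht)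
  refine ⟨κ / b, div_pos hκpos (hgam i₀).1, fun i => c i / κ, fun i =>
    ⟨div_pos (hcpos i) hκpos, ?_⟩⟩
  rw [gammaShapeScale, inv_div]
  exact (hgam i).2

/-! ### Sufficiency of the gamma distribution -/

theorem ext_of_lintegral_laplace {μ ν : Measure ℝ} [IsFiniteMeasure μ] [IsFiniteMeasure ν]
    (hμ : ∀ᵐ x ∂μ, 0 ≤ x) (hν : ∀ᵐ x ∂ν, 0 ≤ x)
    (h : ∀ k : ℕ, ∫⁻ x, ENNReal.ofReal (Real.exp (-(k * x))) ∂μ =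
      ∫⁻ x, ENNReal.ofReal (Real.exp (-(k * x))) ∂ν) : μ = ν := by
  refine ext_of_laplace hμ hν fun k => ?_
  rw [integral_eq_lintegral_of_nonneg_ae (ae_of_all _ fun x => (Real.exp_pos _).le) (by fun_prop),
    integral_eq_lintegral_of_nonneg_ae (ae_of_all _ fun x => (Real.exp_pos _).le) (by fun_prop),
    h k]

/-- Exponential tilting by the sum turns independent gamma variables into a multiple of a
rescaling of the same variables. -/
theorem map_withDensity_exp_sum [MeasurableSpace Ω] {P : Measure Ω} [IsProbabilityMeasure P]
    {X : Fin n → Ω → ℝ} (hX : ∀ i, Measurable (X i)) (hindep : iIndepFun X P)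
    {γ : Fin n → ℝ} {r s : ℝ} (hγ : ∀ i, 0 < γ i) (hr : 0 < r) (hs : 0 < r + s)
    (hlaw : ∀ i, HasLaw (X i) (gammaMeasure (γ i) r) P) :
    (P.map fun ω i => X i ω).withDensity
        (fun x => ENNReal.ofReal (Real.exp (-(s * ∑ i, x i)))) =
      (∏ i, ENNReal.ofReal ((r / (r + s)) ^ γ i)) •
        (P.map fun ω i => X i ω).map (fun x i => r / (r + s) * x i) := by
  have hXm : Measurable fun ω i => X i ω := measurable_pi_lambda _ hX
  have hsc : Measurable fun (x : Fin n → ℝ) i => r / (r + s) * x i := by fun_prop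
  set ν : Fin n → Measure ℝ := fun i =>
    ENNReal.ofReal ((r / (r + s)) ^ γ i) • gammaMeasure (γ i) (r + s) with hν
  have hfin : ∀ i, IsFiniteMeasure (ν i) := fun i => by
    have := isProbabilityMeasure_gammaMeasure (hγ i) hs
    exact Measure.smul_finite _ ENNReal.ofReal_ne_top
  -- Both sides are the product of the tilted marginals: on the left the density factors over boxes,
  -- on the right rescaling by `r / (r + s)` changes the rate `r` into `r + s`.
  trans Measure.pi ν
  · symm
    refine Measure.pi_eq fun B hB => ?_
    have hbox : MeasurableSet (Set.univ.pi B) := MeasurableSet.univ_pi hB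
    rw [withDensity_apply _ hbox, ← lintegral_indicator hbox, lintegral_map ?_ hXm]
    · have e : ∀ ω, (Set.univ.pi B).indicator
          (fun x => ENNReal.ofReal (Real.exp (-(s * ∑ i, x i)))) (fun i => X i ω) =
          ∏ i, (B i).indicator (fun x => ENNReal.ofReal (Real.exp (-(s * x)))) (X i ω) := by
        intro ω
        by_cases hω : (fun i => X i ω) ∈ Set.univ.pi B
        · rw [Set.indicator_of_mem hω, Finset.mul_sum, ← Finset.sum_neg_distrib, Real.exp_sum,
            ENNReal.ofReal_prod_of_nonneg fun i _ => (Real.exp_pos _).le]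
          exact Finset.prod_congr rfl fun i _ =>
            (Set.indicator_of_mem (hω i (Set.mem_univ i))
              (fun x => ENNReal.ofReal (Real.exp (-(s * x))))).symm
        · rw [Set.indicator_of_notMem hω]
          simp only [Set.mem_univ_pi, not_forall] at hω
          obtain ⟨i, hi⟩ := hω
          exact (Finset.prod_eq_zero (Finset.mem_univ i) (Set.indicator_of_notMem hi _)).symm
      simp_rw [e]
      have hm : ∀ i, Measurable
          ((B i).indicator fun x : ℝ => ENNReal.ofReal (Real.exp (-(s * x)))) := fun i =>
        Measurable.indicator (by fun_prop) (hB i)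
      rw [lintegral_prod_eq_prod_lintegral_of_indepFun Finset.univ
        (fun i ω => (B i).indicator (fun x => ENNReal.ofReal (Real.exp (-(s * x)))) (X i ω))
        (hindep.comp _ hm) (fun i => (hm i).comp (hX i))]
      refine Finset.prod_congr rfl fun i _ => ?_
      rw [← lintegral_map (hm i) (hX i), (hlaw i).map_eq, lintegral_indicator (hB i),
        ← withDensity_apply _ (hB i), gammaMeasure_withDensity_exp (hγ i) hr hs]
    · exact Measurable.indicator (by fun_prop) hbox
  · refine Measure.pi_eq fun B hB => ?_
    have hbox : MeasurableSet (Set.univ.pi B) := MeasurableSet.univ_pi hB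
    have hpi := (iIndepFun_iff_map_fun_eq_pi_map fun i => (hX i).aemeasurable).mp hindep
    have hprob : ∀ i, IsProbabilityMeasure (P.map (X i)) := fun i =>
      Measure.isProbabilityMeasure_map (hX i).aemeasurable
    have hpre : (fun (x : Fin n → ℝ) i => r / (r + s) * x i) ⁻¹' Set.univ.pi B =
        Set.univ.pi fun i => (fun x => r / (r + s) * x) ⁻¹' B i := by
      ext x; simp
    rw [Measure.smul_apply, Measure.map_apply hsc hbox, hpi, hpre, Measure.pi_pi, smul_eq_mul,
      ← Finset.prod_mul_distrib]
    refine Finset.prod_congr rfl fun i _ => ?_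
    rw [hν, Measure.smul_apply, smul_eq_mul, (hlaw i).map_eq, ← Measure.map_apply (by fun_prop)
      (hB i), map_mul_gammaMeasure (hγ i) hr (div_pos hr hs), div_div_cancel₀ hr.ne']

theorem indepFun_ratio_aggregate_of_gamma [MeasurableSpace Ω] {P : Measure Ω}
    [IsProbabilityMeasure P] {X : Fin n → Ω → ℝ} (hX : ∀ i, IsLoss P (X i))
    (hindep : iIndepFun X P) {γ : Fin n → ℝ} {r : ℝ} (hγ : ∀ i, 0 < γ i) (hr : 0 < r)
    (hlaw : ∀ i, HasLaw (X i) (gammaMeasure (γ i) r) P) :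
    IndepFun (fun ω i => ratio X i ω) (aggregate X) P := by
  have hXm : Measurable fun ω i => X i ω := measurable_pi_lambda _ fun i => (hX i).1
  have hS := measurable_aggregate fun i => (hX i).1
  have hS0 : ∀ᵐ ω ∂P, 0 ≤ aggregate X ω := (ae_all_pos hX).mono fun ω hω =>
    Finset.sum_nonneg fun i _ => (hω i).le
  have hR : Measurable fun ω i => ratio X i ω :=
    measurable_pi_lambda _ (measurable_ratio fun i => (hX i).1)
  set ρ : (Fin n → ℝ) → Fin n → ℝ := fun x i => x i / ∑ j, x j with hρ
  have hρm : Measurable ρ := by fun_prop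
  have key : ∀ (k : ℕ) (A : Set (Fin n → ℝ)), MeasurableSet A →
      ∫⁻ ω in (fun ω i => ratio X i ω) ⁻¹' A, ENNReal.ofReal (Real.exp (-(k * aggregate X ω))) ∂P =
        (∏ i, ENNReal.ofReal ((r / (r + k)) ^ γ i)) * P ((fun ω i => ratio X i ω) ⁻¹' A) := by
    intro k A hA
    have hk : 0 < r + k := by positivity
    have h := congrArg (fun μ : Measure (Fin n → ℝ) => μ (ρ ⁻¹' A))
      (map_withDensity_exp_sum (fun i => (hX i).1) hindep hγ hr hk hlaw)
    have hsc : Measurable fun (x : Fin n → ℝ) i => r / (r + k) * x i := by fun_prop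
    -- Events of the ratios are invariant under a common rescaling, so the tilted measure of such an
    -- event is a constant times its probability.
    have hinv : (fun (x : Fin n → ℝ) i => r / (r + k) * x i) ⁻¹' (ρ ⁻¹' A) = ρ ⁻¹' A := by
      rw [← Set.preimage_comp]
      congr 1
      ext x i
      simp only [hρ, Function.comp_apply, ← Finset.mul_sum]
      exact mul_div_mul_left _ _ (div_pos hr hk).ne'
    simp only [Measure.smul_apply, smul_eq_mul] at h
    rw [withDensity_apply _ (hρm hA), setLIntegral_map (hρm hA) (by fun_prop) hXm,
      Measure.map_apply hsc (hρm hA), hinv, Measure.map_apply hXm (hρm hA)] at h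
    exact h
  rw [indepFun_iff_measure_inter_preimage_eq_mul]
  intro A B hA hB
  set E := (fun ω i => ratio X i ω) ⁻¹' A with hE
  have hfin : IsFiniteMeasure (P E • P.map (aggregate X)) :=
    Measure.smul_finite _ (measure_ne_top _ _)
  have hνeq : (P.restrict E).map (aggregate X) = P E • P.map (aggregate X) := by
    apply ext_of_lintegral_laplace
    · exact (ae_map_iff hS.aemeasurable measurableSet_Ici).mpr (ae_restrict_of_ae hS0)
    · exact Measure.ae_smul_measure ((ae_map_iff hS.aemeasurable measurableSet_Ici).mpr hS0) _
    · intro k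
      have h1 := key k A hA
      -- Taking the full event identifies the constant as the Laplace transform of the aggregate.
      have h2 := key k Set.univ MeasurableSet.univ
      simp only [Set.preimage_univ, Measure.restrict_univ, measure_univ, mul_one] at h2
      rw [lintegral_map (by fun_prop) hS, lintegral_smul_measure, lintegral_map (by fun_prop) hS,
        h1, h2, smul_eq_mul, mul_comm]
  have h := congrArg (fun μ : Measure ℝ => μ B) hνeq
  simp only [Measure.smul_apply, smul_eq_mul] at h
  rw [Measure.map_apply hS hB, Measure.map_apply hS hB, Measure.restrict_apply (hS hB)] at h
  rw [Set.inter_comm, h]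

/-- The tail event depends on the aggregate alone, so `E[R_i ^ k]` factors out of every tail
integral. -/
theorem mem_frakW_of_indepFun [MeasurableSpace Ω] {P : Measure Ω} [IsProbabilityMeasure P]
    {X : Fin n → Ω → ℝ} (hX : ∀ i, IsLoss P (X i)) {k : ℕ} (hk : ∀ i, MemLp (X i) k P)
    (hind : IndepFun (fun ω i => ratio X i ω) (aggregate X) P) : X ∈ frakW P n k := by
  refine ⟨fun i => ⟨hX i, hk i⟩, fun q _ hq i => ?_⟩
  have hXm := fun i => (hX i).1
  have hS := measurable_aggregate hXm
  have hR : Measurable fun ω i => ratio X i ω := measurable_pi_lambda _ (measurable_ratio hXm)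
  set v := valueAtRisk P (aggregate X) q with hv
  have hEm : MeasurableSet (tailEvent P X q) := measurableSet_lt measurable_const hS
  have hfac : ∀ w : ℝ → ℝ, Measurable w →
      ∫ ω in tailEvent P X q, ratio X i ω ^ k * w (aggregate X ω) ∂P =
        (∫ ω, ratio X i ω ^ k ∂P) * ∫ ω in tailEvent P X q, w (aggregate X ω) ∂P := by
    intro w hw
    have hg : Measurable ((Set.Ioi v).indicator w) := hw.indicator measurableSet_Ioi
    have h := hind.integral_comp_mul_comp (f := fun x : Fin n → ℝ => x i ^ k)
      (g := (Set.Ioi v).indicator w) hR.aemeasurable hS.aemeasurable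
      ((measurable_pi_apply i).pow_const k).aestronglyMeasurable hg.aestronglyMeasurable
    rw [← integral_indicator hEm, ← integral_indicator hEm]
    have e1 : (tailEvent P X q).indicator (fun ω => ratio X i ω ^ k * w (aggregate X ω)) =
        fun ω => ratio X i ω ^ k * (Set.Ioi v).indicator w (aggregate X ω) := by
      ext ω
      exact Set.indicator_mul_right (tailEvent P X q) (fun ω => ratio X i ω ^ k)
        (fun ω => w (aggregate X ω))
    rw [e1]
    exact h
  have h1 : ∫ ω in tailEvent P X q, X i ω ^ k ∂P =
      (∫ ω, ratio X i ω ^ k ∂P) * ∫ ω in tailEvent P X q, aggregate X ω ^ k ∂P := by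
    rw [← hfac (fun x => x ^ k) (by fun_prop)]
    refine integral_congr_ae (ae_restrict_of_ae ?_)
    filter_upwards [ae_all_pos hX] with ω hω
    rw [← mul_pow, ratio_mul_aggregate hω]
  have h2 : ∫ ω in tailEvent P X q, ratio X i ω ^ k ∂P =
      (∫ ω, ratio X i ω ^ k ∂P) * P.real (tailEvent P X q) := by
    simpa using hfac (fun _ => 1) measurable_const
  have hSpos : 0 < ∫ ω in tailEvent P X q, aggregate X ω ^ k ∂P := by
    have hp : ∀ᵐ ω ∂P, 0 < aggregate X ω ^ k :=
      (ae_all_pos hX).mono fun ω hω => pow_pos (aggregate_pos hω i) k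
    rw [setIntegral_pos_iff_support_of_nonneg_ae (ae_restrict_of_ae (hp.mono fun ω hω => hω.le))
      (integrable_aggregate_pow hX hk).integrableOn]
    refine lt_of_lt_of_le hq (measure_mono_ae ?_)
    filter_upwards [hp] with ω hω hωE using ⟨hω.ne', hωE⟩
  have hPpos : 0 < P.real (tailEvent P X q) := ENNReal.toReal_pos hq.ne' (measure_ne_top _ _)
  rw [propAlloc, ratioAlloc, tailExp_eq Filter.EventuallyEq.rfl,
    tailExp_eq Filter.EventuallyEq.rfl, tailExp_eq Filter.EventuallyEq.rfl, h1, h2]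
  field_simp

end LossPortfolio

theorem mainTheorem3 {Ω : Type*} [MeasurableSpace Ω] (P : Measure Ω) [IsProbabilityMeasure P]
    (n : ℕ) (hn : 2 ≤ n) (X : Fin n → Ω → ℝ)
    (hX : ∀ i, LossPortfolio.IsLoss P (X i))
    (hindep : iIndepFun X P)
    (hnondeg : ¬ ∃ c : ℝ, ∀ᵐ ω ∂P, LossPortfolio.aggregate X ω = c) :
    (X ∈ LossPortfolio.frakW P n 1 ∩ LossPortfolio.frakW P n 2 ↔
      ∃ θ : ℝ, 0 < θ ∧ ∃ γ : Fin n → ℝ,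
        ∀ i, 0 < γ i ∧ HasLaw (X i) (LossPortfolio.gammaShapeScale (γ i) θ) P) ∧
    (X ∈ LossPortfolio.frakW P n 1 ∩ LossPortfolio.frakW P n 2 →
      IndepFun (fun ω i => LossPortfolio.ratio X i ω) (LossPortfolio.aggregate X) P) := by
  have hnec : X ∈ LossPortfolio.frakW P n 1 ∩ LossPortfolio.frakW P n 2 →
      ∃ θ : ℝ, 0 < θ ∧ ∃ γ : Fin n → ℝ,
        ∀ i, 0 < γ i ∧ HasLaw (X i) (LossPortfolio.gammaShapeScale (γ i) θ) P :=
    fun h => LossPortfolio.hasLaw_gamma_of_mem_frakW hn hindep hnondeg h.1 h.2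
  have hind : (∃ θ : ℝ, 0 < θ ∧ ∃ γ : Fin n → ℝ,
        ∀ i, 0 < γ i ∧ HasLaw (X i) (LossPortfolio.gammaShapeScale (γ i) θ) P) →
      IndepFun (fun ω i => LossPortfolio.ratio X i ω) (LossPortfolio.aggregate X) P := by
    rintro ⟨θ, hθ, γ, h⟩
    exact LossPortfolio.indepFun_ratio_aggregate_of_gamma hX hindep (fun i => (h i).1)
      (inv_pos.mpr hθ) (fun i => (h i).2)
  refine ⟨⟨hnec, fun h => ?_⟩, fun h => hind (hnec h)⟩
  -- Gamma laws have moments of all orders, so membership holds for every `k`.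
  have hmem : ∀ k : ℕ, X ∈ LossPortfolio.frakW P n k := fun k => by
    refine LossPortfolio.mem_frakW_of_indepFun hX (fun i => ?_) (hind h)
    obtain ⟨θ, hθ, γ, h⟩ := h
    have hm := LossPortfolio.memLp_id_gammaMeasure (h i).1 (inv_pos.mpr hθ) k
    have hlaw : P.map (X i) = gammaMeasure (γ i) θ⁻¹ := (h i).2.map_eq
    rw [← hlaw] at hm
    exact (memLp_map_measure_iff (by fun_prop) (hX i).1.aemeasurable).mp hm
  exact ⟨hmem 1, hmem 2⟩
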